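/- Let $G$ be an abelian group. All cohomology is singular cohomology with coefficients in $G$, and $H^n(X)$ means $H^n(X,\emptyset)$. A Hausdorff pair $(X,X_0)$ is a Hausdorff space $X$ with a subset $X_0$ (with the subspace topology); it is a compact Hausdorff pair if $X$ and $X_0$ are compact. Let $\mathrm{HCpt}^2$ be the category of compact Hausdorff pairs and homotopy classes of continuous maps of pairs (homotopies being through maps of pairs). For a Hausdorff pair $(X,X_0)$ let $c(X,X_0)$ be the set of pairs $(K,K_0)$ of compact subsets $K\subseteq X$, $K_0\subseteq K\cap X_0$, directed by inclusion, and let $C(X,X_0)$ be the direct system in $\mathrm{HCpt}^2$ of the pairs $(K,K_0)\in c(X,X_0)$ and the homotopy classes of the inclusion maps. The $n$-th CH-shape cohomology group is $$\hat H^n(X,X_0)=\varprojlim_{(K,K_0)\in c(X,X_0)}H^n(K,K_0),\qquad n\ge 0,$$ and $\hat H^n(X_0)$ means $\hat H^n(X_0,\emptyset)$. A continuous map of pairs $\varphi:(X,X_0)\to(Y,Y_0)$ induces the homomorphism $\hat\varphi^n:\hat H^n(Y,Y_0)\to\hat H^n(X,X_0)$ whose component at $(K,K_0)$ is the projection to $H^n(\varphi(K),\varphi(K_0))$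 followed by the homomorphism induced by $\varphi|_K:(K,K_0)\to(\varphi(K),\varphi(K_0))$. The coboundary $\hat\delta^n:\hat H^n(X_0)\to\hat H^{n+1}(X,X_0)$ has as component at $(K,K_0)$ the projection to $H^n(K_0)$ followed by the singular coboundary $H^n(K_0)\to H^{n+1}(K,K_0)$. Two direct systems are called equivalent if there are morphisms of direct systems $F$ and $F'$ in the two directions with $F'F\sim 1$ and $FF'\sim 1$. Here a morphism of direct systems $(X_a)_{a\in A}\to(Y_b)_{b\in B}$ is an order-preserving map $f:A\to B$ with morphisms $f_a:X_a\to Y_{f(a)}$ commuting with the transition morphisms, and $(f_a,f)\sim(g_a,g)$ means that for each $a\in A$ there is $b\ge f(a),g(a)$ such that $f_a$ and $g_a$ become equal after composition with the transition morphisms to $Y_b$. **Theorem.** On compact Hausdorff pairs, CH-shape cohomology theory and singular cohomology theory coincide. That is: 1. for every compact Hausdorff pair $(X,X_0)$, the system $C(X,X_0)$ is equivalent to the one-element system $\{(X,X_0),[1_{(X,X_0)}]\}$; 2. for every $n\ge 0$ there are isomorphisms $\Phi^n_{(X,X_0)}:H^n(X,X_0)\to\hat H^n(X,X_0)$ for all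 compact Hausdorff pairs $(X,X_0)$, natural with respect to all continuous maps of pairs, whose component at each $(K,K_0)\in c(X,X_0)$ is the homomorphism $H^n(X,X_0)\to H^n(K,K_0)$ induced by the inclusion, and which commute with the coboundaries: $\Phi^{n+1}_{(X,X_0)}\,\delta^n=\hat\delta^n\,\Phi^n_{(X_0,\emptyset)}$ for the singular coboundary $\delta^n:H^n(X_0)\to H^{n+1}(X,X_0)$. -/

import Mathlib

universe u v u' u'' w

namespace CHShape

open CategoryTheory Limits Opposite Simplicial AlgebraicTopology MonoidalCategory

noncomputable section

/-! ### Homotopies of cosimplicial objects and of kernels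

Helper facts for the homotopy invariance of relative singular cohomology. -/

section CosimplicialHomotopy

variable {C : Type u} [Category.{v} C] [Preadditive C] {X Y X' Y' : CosimplicialObject C}
  {f g : X ⟶ Y} {f' g' : X' ⟶ Y'}

/-- A map of cosimplicial objects as a map of simplicial objects of the opposite category. -/
abbrev opMap {X Y : CosimplicialObject C} (f : X ⟶ Y) :=
  (cosimplicialSimplicialEquiv C).functor.map f.op

/-- The components of the cochain homotopy given by a combinatorial homotopy. -/
def prism (H : SimplicialObject.Homotopy (opMap f) (opMap g)) (i j : ℕ) :
    X.obj ⦋i⦌ ⟶ Y.obj ⦋j⦌ :=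
  Quiver.Hom.unop (X := op (Y.obj ⦋j⦌)) (Y := op (X.obj ⦋i⦌)) (H.toChainHomotopy.hom j i)

theorem coface_d (Y : CosimplicialObject C) (n : ℕ) :
    ((alternatingCofaceMapComplex C).obj Y).d n (n + 1) =
      AlternatingCofaceMapComplex.objD Y n :=
  CochainComplex.of_d (fun n => Y.obj ⦋n⦌) (AlternatingCofaceMapComplex.objD Y) n

theorem face_d (Y : CosimplicialObject C) (n : ℕ) :
    ((alternatingFaceMapComplex Cᵒᵖ).obj
      ((cosimplicialSimplicialEquiv C).functor.obj (op Y))).d (n + 1) n =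
        (AlternatingCofaceMapComplex.objD Y n).op := by
  rw [AlternatingCofaceMapComplex.d_eq_unop_d]
  exact alternatingFaceMapComplex_obj_d _ _

theorem prism_zero (H : SimplicialObject.Homotopy (opMap f) (opMap g)) :
    f.app ⦋0⦌ = AlternatingCofaceMapComplex.objD X 0 ≫ prism H 1 0 + g.app ⦋0⦌ := by
  have h := H.toChainHomotopy.comm 0
  rw [Homotopy.dNext_zero_chainComplex, Homotopy.prevD_chainComplex, face_d, zero_add] at h
  exact congrArg Quiver.Hom.unop h

theorem prism_succ (H : SimplicialObject.Homotopy (opMap f) (opMap g)) (n : ℕ) :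
    f.app ⦋n + 1⦌ = AlternatingCofaceMapComplex.objD X (n + 1) ≫ prism H (n + 2) (n + 1) +
      prism H (n + 1) n ≫ AlternatingCofaceMapComplex.objD Y n + g.app ⦋n + 1⦌ := by
  rw [add_comm (AlternatingCofaceMapComplex.objD X (n + 1) ≫ prism H (n + 2) (n + 1))]
  have h := H.toChainHomotopy.comm (n + 1)
  rw [Homotopy.dNext_succ_chainComplex, Homotopy.prevD_chainComplex, face_d, face_d] at h
  exact congrArg Quiver.Hom.unop h

/-- `prism`, as a map between the terms of the alternating coface map complexes. -/
def prismHom (H : SimplicialObject.Homotopy (opMap f) (opMap g)) (i j : ℕ) :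
    ((alternatingCofaceMapComplex C).obj X).X i ⟶ ((alternatingCofaceMapComplex C).obj Y).X j :=
  prism H i j

/-- A combinatorial homotopy induces a homotopy of alternating coface map complexes. -/
def cochainHomotopy (H : SimplicialObject.Homotopy (opMap f) (opMap g)) :
    Homotopy ((alternatingCofaceMapComplex C).map f) ((alternatingCofaceMapComplex C).map g) where
  hom := prismHom H
  zero i j h := by
    dsimp [prismHom, prism]
    rw [H.toChainHomotopy.zero _ _ (by simpa using h)]
    rfl
  comm n := by
    cases n with
    | zero =>
      rw [Homotopy.dNext_cochainComplex, Homotopy.prevD_zero_cochainComplex, coface_d, add_zero]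
      exact prism_zero H
    | succ n =>
      rw [Homotopy.dNext_cochainComplex, Homotopy.prevD_succ_cochainComplex, coface_d, coface_d]
      exact prism_succ H n

theorem prism_comm (H : SimplicialObject.Homotopy (opMap f) (opMap g))
    (H' : SimplicialObject.Homotopy (opMap f') (opMap g')) (p : X ⟶ X') (q : Y ⟶ Y')
    (h : ∀ (n : ℕ) (k : Fin (n + 1)),
      (opMap q).app (op ⦋n⦌) ≫ H.h k = H'.h k ≫ (opMap p).app (op ⦋n + 1⦌)) (i j : ℕ) :
    prism H i j ≫ q.app ⦋j⦌ = p.app ⦋i⦌ ≫ prism H' i j := by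
  refine Quiver.Hom.op_inj ?_
  change (opMap q).app (op ⦋j⦌) ≫ SimplicialObject.Homotopy.ToChainHomotopy.hom H j i =
    SimplicialObject.Homotopy.ToChainHomotopy.hom H' j i ≫ (opMap p).app (op ⦋i⦌)
  by_cases hij : j + 1 = i
  · subst hij
    rw [SimplicialObject.Homotopy.ToChainHomotopy.hom_eq,
      SimplicialObject.Homotopy.ToChainHomotopy.hom_eq, Preadditive.comp_neg,
      Preadditive.neg_comp, Preadditive.comp_sum, Preadditive.sum_comp]
    simp only [Preadditive.comp_zsmul, Preadditive.zsmul_comp, h]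
  · rw [SimplicialObject.Homotopy.ToChainHomotopy.hom_eq_zero _ _ _ hij,
      SimplicialObject.Homotopy.ToChainHomotopy.hom_eq_zero _ _ _ hij, comp_zero, zero_comp]

end CosimplicialHomotopy

section KernelHomotopy

variable {A : Type u} [Category.{v} A] [Abelian A] {K L K' L' : CochainComplex A ℕ}

theorem kernel_exact_f (b : L ⟶ L') (i : ℕ) :
    (ShortComplex.mk ((kernel.ι b).f i) (b.f i) (by
      rw [← HomologicalComplex.comp_f, kernel.condition, HomologicalComplex.zero_f])).Exact :=
  (HomologicalComplex.exact_iff_degreewise_exact _).1 (ShortComplex.exact_kernel b) i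

theorem homologyMap_kernelMap_eq (a : K ⟶ K') (b : L ⟶ L') {φ ψ : K ⟶ L} {φ' ψ' : K' ⟶ L'}
    (wφ : a ≫ φ' = φ ≫ b) (wψ : a ≫ ψ' = ψ ≫ b) (h : Homotopy φ ψ) (h' : Homotopy φ' ψ')
    (w : ∀ i j, a.f i ≫ h'.hom i j = h.hom i j ≫ b.f j) (n : ℕ) :
    HomologicalComplex.homologyMap (kernel.map a b φ φ' wφ) n =
      HomologicalComplex.homologyMap (kernel.map a b ψ ψ' wψ) n := by
  have hw (i j) : ((kernel.ι a).f i ≫ h.hom i j) ≫ b.f j = 0 := by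
    rw [Category.assoc, ← w, ← Category.assoc, ← HomologicalComplex.comp_f, kernel.condition,
      HomologicalComplex.zero_f, zero_comp]
  let s (i j) := (kernel_exact_f b j).lift ((kernel.ι a).f i ≫ h.hom i j) (hw i j)
  have hs (i j) : s i j ≫ (kernel.ι b).f j = (kernel.ι a).f i ≫ h.hom i j :=
    (kernel_exact_f b j).lift_f _ _
  let T : Homotopy (kernel.map a b φ φ' wφ) (kernel.map a b ψ ψ' wψ) :=
    { hom := s
      zero i j hij := by
        rw [← cancel_mono ((kernel.ι b).f j), hs, h.zero _ _ hij, comp_zero, zero_comp]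
      comm i := by
        rw [← cancel_mono ((kernel.ι b).f i), Preadditive.add_comp, Preadditive.add_comp,
          ← dNext_comp_right, ← prevD_comp_right, ← HomologicalComplex.comp_f,
          ← HomologicalComplex.comp_f]
        simp only [kernel.lift_ι, hs, kernel.map]
        rw [dNext_comp_left, prevD_comp_left, HomologicalComplex.comp_f,
          HomologicalComplex.comp_f, h.comm i]
        simp }
  exact T.homologyMap_eq n

end KernelHomotopy

/-! ### Relative singular cohomology

Pairs of spaces are the objects of Mathlib's `TopPair`, i.e. topological embeddings `X₀ ⟶ X`;
`P.fst` is `X` and `P.snd` is `X₀`. -/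

section SingularCohomology

variable (G : Type v) [AddCommGroup G]

/-- The group of all functions from a set to `G`, as a contravariant functor of the set. -/
def functionsInto : (Type u)ᵒᵖ ⥤ AddCommGrpCat.{max u v} where
  obj S := AddCommGrpCat.of (S.unop → G)
  map f := AddCommGrpCat.ofHom
    { toFun := fun φ s => φ (f.unop s)
      map_zero' := rfl
      map_add' := fun _ _ => rfl }

/-- The cosimplicial abelian group `[n] ↦ (Sₙ → G)` of a simplicial set `S`. -/
def simplicialCochains :
    SSet.{u}ᵒᵖ ⥤ CosimplicialObject AddCommGrpCat.{max u v} where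
  obj S := S.unop.rightOp ⋙ functionsInto G
  map f := Functor.whiskerRight (NatTrans.rightOp f.unop) (functionsInto G)

/-- The singular cochain complex `C^*(X; G)`: an `n`-cochain is a function from the singular
`n`-simplices of `X` to `G`, and `(dφ)(σ) = ∑ i, (-1) ^ i • φ (σ ∘ δ i)`. -/
def cochainFunctor :
    TopCat.{u}ᵒᵖ ⥤ CochainComplex AddCommGrpCat.{max u v} ℕ :=
  TopCat.toSSet.op ⋙ simplicialCochains G ⋙ AlgebraicTopology.alternatingCofaceMapComplex _

/-- The restriction of cochains `C^*(X; G) ⟶ C^*(X₀; G)` of a pair `(X, X₀)`. -/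
def restrictToSubspace (P : TopPair.{u}) :
    (cochainFunctor G).obj (op P.fst) ⟶ (cochainFunctor G).obj (op P.snd) :=
  (cochainFunctor G).map P.map.op

theorem restrict_comm {P Q : TopPair.{u}} (f : P ⟶ Q) :
    restrictToSubspace G Q ≫ (cochainFunctor G).map (TopPair.Hom.snd f).op =
      (cochainFunctor G).map (TopPair.Hom.fst f).op ≫ restrictToSubspace G P := by
  simp only [restrictToSubspace, ← Functor.map_comp, ← op_comp, TopPair.Hom.w]

/-- The relative singular cochain complex `C^*(X, X₀; G)`: the subcomplex of the cochains of `X`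
that vanish on the singular simplices of `X₀`. -/
def relCochainFunctor :
    TopPair.{u}ᵒᵖ ⥤ CochainComplex AddCommGrpCat.{max u v} ℕ where
  obj P := kernel (restrictToSubspace G P.unop)
  map f := kernel.map _ _ ((cochainFunctor G).map (TopPair.Hom.fst f.unop).op)
    ((cochainFunctor G).map (TopPair.Hom.snd f.unop).op) (restrict_comm G f.unop)
  map_id P := by
    apply equalizer.hom_ext
    simp only [kernel.map, equalizer_as_kernel, kernel.lift_ι]
    exact (congrArg _ ((cochainFunctor G).map_id _)).trans ((Category.comp_id _).trans (Category.id_comp _).symm)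
  map_comp f g := by
    apply equalizer.hom_ext
    simp only [kernel.map, equalizer_as_kernel, kernel.lift_ι, Category.assoc, kernel.lift_ι_assoc]
    exact congrArg _ ((cochainFunctor G).map_comp (TopPair.Hom.fst f.unop).op (TopPair.Hom.fst g.unop).op)

/-- The sequence `0 ⟶ C^*(X, X₀) ⟶ C^*(X) ⟶ C^*(X₀) ⟶ 0` is exact. -/
theorem shortExact (P : TopPair.{u}) :
    (ShortComplex.mk (kernel.ι (restrictToSubspace G P)) (restrictToSubspace G P)
      (kernel.condition _)).ShortExact := by
  have : ∀ n, Epi ((restrictToSubspace G P).f n) := by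
    intro n
    rw [AddCommGrpCat.epi_iff_surjective]
    intro φ
    change (TopCat.toSSet.obj P.snd) _⦋n⦌ → G at φ
    have hinj : Function.Injective ((TopCat.toSSet.map P.map).app (op ⦋n⦌)) := by
      intro σ τ h
      refine (TopCat.toSSetObjEquiv _ _).injective ?_
      ext x : 1
      refine P.isEmbedding_map.injective ?_
      exact congrArg (fun ρ => (TopCat.toSSetObjEquiv P.fst (op ⦋n⦌)) ρ x) h
    exact ⟨Function.extend ((TopCat.toSSet.map P.map).app (op ⦋n⦌)) φ 0, funext fun σ => hinj.extend_apply φ 0 σ⟩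
  have := HomologicalComplex.epi_of_epi_f (restrictToSubspace G P) this
  exact { exact := ShortComplex.exact_kernel _ }

/-- A homotopy of maps of spaces induces a combinatorial homotopy on cochains. -/
def spaceHomotopy {X Y : TopCat.{u}} {f g : X ⟶ Y} (H : TopCat.Homotopy f g) :
    SimplicialObject.Homotopy (opMap ((simplicialCochains G).map (TopCat.toSSet.map f).op))
      (opMap ((simplicialCochains G).map (TopCat.toSSet.map g).op)) :=
  H.toSSet.toSimplicialObjectHomotopy.whiskerRight (functionsInto G).rightOp

/-- The `n`-th relative singular cohomology `H^n(X, X₀; G)`, a contravariant functor on pairs. -/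
def cohomology (n : ℕ) : TopPair.{u}ᵒᵖ ⥤ AddCommGrpCat.{max u v} :=
  relCochainFunctor G ⋙ HomologicalComplex.homologyFunctor _ _ n

theorem simplicialHomotopy_comm {P Q : TopPair.{u}} {f g : P ⟶ Q} (F : TopPair.Homotopy f g) (n : ℕ)
    (k : Fin (n + 1)) : 
    F.snd.toSSet.toSimplicialObjectHomotopy.h k ≫ (TopCat.toSSet.map Q.map).app (op ⦋n + 1⦌) =
      (TopCat.toSSet.map P.map).app (op ⦋n⦌) ≫ F.fst.toSSet.toSimplicialObjectHomotopy.h k := by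
  have h : F.snd.toSSet.h ≫ TopCat.toSSet.map Q.map =
      TopCat.toSSet.map P.map ▷ Δ[1] ≫ F.fst.toSSet.h := by
    simp only [TopCat.Homotopy.toSSet, Category.assoc, ← Functor.map_comp, ← F.w]
    rw [Functor.map_comp, ← Functor.LaxMonoidal.μ_natural_left_assoc, whisker_exchange_assoc]
  ext σ
  have h' := congrArg (fun t => (SSet.yonedaEquiv.symm σ ▷ Δ[1] ≫ t).app _
    (SSet.prodStdSimplex.nonDegenerateEquiv₁ k).1) h
  refine Eq.trans h' ?_
  dsimp only
  rw [← comp_whiskerRight_assoc, SSet.yonedaEquiv_symm_comp]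
  rfl

theorem cohomology_map_eq_of_homotopic (n : ℕ) {P Q : TopPair.{u}}
    {f g : P ⟶ Q} (h : TopPair.Homotopic f g) :
    (cohomology G n).map f.op = (cohomology G n).map g.op := by
  obtain ⟨F⟩ := h
  refine homologyMap_kernelMap_eq _ _ (restrict_comm G f) (restrict_comm G g) (cochainHomotopy (spaceHomotopy G F.fst))
    (cochainHomotopy (spaceHomotopy G F.snd)) (fun i j => ?_) n
  refine (prism_comm (spaceHomotopy G F.fst) (spaceHomotopy G F.snd)
    ((simplicialCochains G).map (TopCat.toSSet.map Q.map).op)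
    ((simplicialCochains G).map (TopCat.toSSet.map P.map).op) (fun m k => ?_) i j).symm
  exact (congrArg (functionsInto G).rightOp.map (simplicialHomotopy_comm F m k)).symm

/-- The coboundary homomorphism `H^n(X₀; G) ⟶ H^{n+1}(X, X₀; G)` of the long exact cohomology
sequence; as usual `H^n(X₀)` is `H^n(X₀, ∅)`, and the first factor is induced by the inclusion
(an isomorphism) `C^*(X₀, ∅) ⟶ C^*(X₀)`. -/
def coboundary (P : TopPair.{u}) (n : ℕ) :
    (cohomology G n).obj (op (TopPair.incl.obj P.snd)) ⟶ (cohomology G (n + 1)).obj (op P) :=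
  HomologicalComplex.homologyMap
      (kernel.ι (restrictToSubspace G (TopPair.incl.obj P.snd))) n ≫
    (shortExact G P).δ n (n + 1) (by simp)

theorem coboundary_naturality {P Q : TopPair.{u}} (f : P ⟶ Q) (n : ℕ) :
    (cohomology G n).map (TopPair.incl.map (TopPair.Hom.snd f)).op ≫ coboundary G P n =
      coboundary G Q n ≫ (cohomology G (n + 1)).map f.op := by
  let φ : ShortComplex.mk (kernel.ι (restrictToSubspace G Q)) (restrictToSubspace G Q)
      (kernel.condition _) ⟶
        ShortComplex.mk (kernel.ι (restrictToSubspace G P)) (restrictToSubspace G P)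
      (kernel.condition _) :=
    { τ₁ := (relCochainFunctor G).map f.op
      τ₂ := (cochainFunctor G).map (TopPair.Hom.fst f).op
      τ₃ := (cochainFunctor G).map (TopPair.Hom.snd f).op
      comm₁₂ := kernel.lift_ι _ _ _
      comm₂₃ := (restrict_comm G f).symm }
  have h := HomologicalComplex.HomologySequence.δ_naturality φ (shortExact G Q) (shortExact G P)
    n (n + 1) (by simp)
  have h' : (relCochainFunctor G).map (TopPair.incl.map (TopPair.Hom.snd f)).op ≫
      kernel.ι (restrictToSubspace G (TopPair.incl.obj P.snd)) =
        kernel.ι (restrictToSubspace G (TopPair.incl.obj Q.snd)) ≫ φ.τ₃ :=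
    kernel.lift_ι _ _ _
  have h'' : HomologicalComplex.homologyMap
        ((relCochainFunctor G).map (TopPair.incl.map (TopPair.Hom.snd f)).op) n ≫
      HomologicalComplex.homologyMap
        (kernel.ι (restrictToSubspace G (TopPair.incl.obj P.snd))) n =
      HomologicalComplex.homologyMap
        (kernel.ι (restrictToSubspace G (TopPair.incl.obj Q.snd))) n ≫
      HomologicalComplex.homologyMap φ.τ₃ n :=
    (HomologicalComplex.homologyMap_comp _ _ n).symm.trans
      ((congrArg (fun t => HomologicalComplex.homologyMap t n) h').trans
        (HomologicalComplex.homologyMap_comp _ _ n))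
  exact (Category.assoc _ _ _).symm.trans ((congrArg (· ≫ _) h'').trans
    ((Category.assoc _ _ _).trans ((congrArg (_ ≫ ·) h.symm).trans (Category.assoc _ _ _).symm)))

end SingularCohomology

/-! ### Direct systems and the category `Dir-𝒞` -/

/-- A direct system in a category, indexed by a directed preordered set. -/
structure DirectSystem (𝒞 : Type v) [Category.{w} 𝒞] where
  index : Type u
  [preorder : Preorder index]
  [directed : IsDirectedOrder index]
  system : index ⥤ 𝒞

attribute [instance] DirectSystem.preorder DirectSystem.directed

namespace DirectSystem
variable {𝒞 : Type v} [Category.{w} 𝒞]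

/-- A morphism of direct systems. -/
structure Hom (X : DirectSystem.{u} 𝒞) (Y : DirectSystem.{u'} 𝒞) where
  indexMap : X.index →o Y.index
  app (a : X.index) : X.system.obj a ⟶ Y.system.obj (indexMap a)
  comm {a a' : X.index} (h : a ≤ a') :
    app a ≫ Y.system.map (homOfLE (indexMap.monotone h)) = X.system.map (homOfLE h) ≫ app a'

/-- The identity morphism of a direct system. -/
def Hom.id (X : DirectSystem.{u} 𝒞) : Hom X X where
  indexMap := OrderHom.id
  app a := 𝟙 (X.system.obj a)
  comm _ := (Category.id_comp _).trans (Category.comp_id _).symm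

/-- The composition of morphisms of direct systems (first `F`, then `F'`). -/
def Hom.comp {X : DirectSystem.{u} 𝒞} {Y : DirectSystem.{u'} 𝒞} {Z : DirectSystem.{u''} 𝒞}
    (F : Hom X Y) (F' : Hom Y Z) : Hom X Z where
  indexMap := F'.indexMap.comp F.indexMap
  app a := F.app a ≫ F'.app (F.indexMap a)
  comm {a a'} h := by
    have h₁ := F.comm h
    have h₂ := F'.comm (F.indexMap.monotone h)
    calc (F.app a ≫ F'.app _) ≫ Z.system.map (homOfLE _)
        = F.app a ≫ F'.app _ ≫ Z.system.map (homOfLE _) := Category.assoc _ _ _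
      _ = F.app a ≫ Y.system.map (homOfLE (F.indexMap.monotone h)) ≫ F'.app _ := by rw [h₂]
      _ = X.system.map (homOfLE h) ≫ F.app a' ≫ F'.app _ := by
        rw [← Category.assoc, h₁, Category.assoc]

/-- The equivalence relation on morphisms of direct systems that defines the morphisms of
`Dir-𝒞`; for systems of spaces up to homotopy it is called homotopy. -/
def Hom.Homotopic {X : DirectSystem.{u} 𝒞} {Y : DirectSystem.{u'} 𝒞} (F F' : Hom X Y) : Prop :=
  ∀ a : X.index, ∃ (b : Y.index) (h : F.indexMap a ≤ b) (h' : F'.indexMap a ≤ b),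
    F.app a ≫ Y.system.map (homOfLE h) = F'.app a ≫ Y.system.map (homOfLE h')

/-- Two direct systems are equivalent if they are isomorphic in `Dir-𝒞`. -/
def Equivalent (X : DirectSystem.{u} 𝒞) (Y : DirectSystem.{u'} 𝒞) : Prop :=
  ∃ (F : Hom X Y) (F' : Hom Y X),
    (F.comp F').Homotopic (Hom.id X) ∧ (F'.comp F).Homotopic (Hom.id Y)

/-- The direct system `{X, 1_X}` with one object, indexed by a singleton. -/
def single (X : 𝒞) : DirectSystem.{0} 𝒞 where
  index := Unit
  system := (Functor.const Unit).obj X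

end DirectSystem

/-! ### Compact Hausdorff pairs up to homotopy -/

section HCpt

/-- `X` is Hausdorff (hence so is the subspace `X₀`). -/
def IsHausdorffPair : ObjectProperty TopPair.{u} := fun P => T2Space P.fst

/-- `X` is Hausdorff, and both `X` and `X₀` are compact. -/
def IsCompactHausdorffPair : ObjectProperty TopPair.{u} := fun P =>
  T2Space P.fst ∧ CompactSpace P.fst ∧ CompactSpace P.snd

/-- The category of Hausdorff pairs and continuous maps of pairs. -/
abbrev HausdorffPair := IsHausdorffPair.{u}.FullSubcategory

/-- The category of compact Hausdorff pairs and continuous maps of pairs. -/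
abbrev CompactHausdorffPair := IsCompactHausdorffPair.{u}.FullSubcategory

/-- A compact Hausdorff pair is a Hausdorff pair. -/
def CompactHausdorffPair.inclusion : CompactHausdorffPair.{u} ⥤ HausdorffPair.{u} :=
  ObjectProperty.ιOfLE fun _ h => h.1

/-- Homotopy of maps of pairs, through maps of pairs. -/
def homotopyRel : HomRel CompactHausdorffPair.{u} := fun _ _ f g =>
  TopPair.Homotopic f.hom g.hom

instance : Congruence homotopyRel.{u} where
  equivalence := ⟨fun _ => TopPair.Homotopic.equivalence.refl _,
    fun h => TopPair.Homotopic.equivalence.symm h,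
    fun h h' => TopPair.Homotopic.equivalence.trans h h'⟩
  comp_left f _ _ h := h.map fun H => H.comp (.refl f.hom)
  comp_right g h := h.map fun H => TopPair.Homotopy.comp (.refl g.hom) H

/-- The category `HCpt²`: compact Hausdorff pairs and homotopy classes of maps of pairs. -/
abbrev HCpt2 := CategoryTheory.Quotient homotopyRel.{u}

variable (G : Type v) [AddCommGroup G]

/-- Singular cohomology `H^n( - ; G)` as a contravariant functor on `HCpt²`. -/
def homotopyCohomology (n : ℕ) : HCpt2.{u}ᵒᵖ ⥤ AddCommGrpCat.{max u v} :=
  (CategoryTheory.Quotient.lift homotopyRel.{u} (IsCompactHausdorffPair.ι ⋙ (cohomology G n).rightOp)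
    fun _ _ _ _ h => congrArg Quiver.Hom.op (cohomology_map_eq_of_homotopic G n h)).leftOp

end HCpt

/-! ### Compact subpairs of a pair -/

/-- A compact subpair `(K, K₀)` of a pair `(X, X₀)`: compact subsets `K` of `X` and `K₀` of `X₀`
with `K₀ ⊆ K` (as subsets of `X`). -/
@[ext]
structure CompactSubpair (P : TopPair.{u}) where
  total : TopologicalSpace.Compacts P.fst
  sub : TopologicalSpace.Compacts P.snd
  mapsTo : Set.MapsTo P.map (sub : Set P.snd) (total : Set P.fst)

namespace CompactSubpair

variable {P Q : TopPair.{u}}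

/-- Inclusion: `(K, K₀) ≤ (L, L₀)` if `K ⊆ L` and `K₀ ⊆ L₀`. -/
instance : PartialOrder (CompactSubpair P) :=
  PartialOrder.lift (fun K => (K.total, K.sub)) fun K L h => by
    cases K; cases L; simp_all

instance : IsDirectedOrder (CompactSubpair P) where
  directed K L :=
    ⟨⟨K.total ⊔ L.total, K.sub ⊔ L.sub, fun _ hx => hx.elim (fun h => Or.inl (K.mapsTo h)) fun h => Or.inr (L.mapsTo h)⟩, 
      ⟨le_sup_left, le_sup_left⟩, ⟨le_sup_right, le_sup_right⟩⟩

/-- The pair of spaces `(K, K₀)`. -/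
abbrev toTopPair (K : CompactSubpair P) : TopPair.{u} :=
  TopPair.of (A := TopCat.of K.sub) (X := TopCat.of K.total)
    (TopCat.ofHom ⟨K.mapsTo.restrict, P.map.hom.continuous.restrict K.mapsTo⟩)
    (P.isEmbedding_map.restrict K.mapsTo)

/-- The inclusion map `(K, K₀) ⟶ (L, L₀)`. -/
abbrev transition {K L : CompactSubpair P} (h : K ≤ L) : K.toTopPair ⟶ L.toTopPair :=
  TopPair.ofHom (TopCat.ofHom ⟨Set.inclusion h.1, continuous_inclusion h.1⟩)
    (TopCat.ofHom ⟨Set.inclusion h.2, continuous_inclusion h.2⟩)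

/-- The inclusion map `(K, K₀) ⟶ (X, X₀)`. -/
abbrev inclusion (K : CompactSubpair P) : K.toTopPair ⟶ P :=
  TopPair.ofHom (TopCat.ofHom ⟨Subtype.val, continuous_subtype_val⟩)
    (TopCat.ofHom ⟨Subtype.val, continuous_subtype_val⟩)

/-- The image `(f(K), f(K₀))` of a compact subpair under a map of pairs `f`. -/
def image (f : P ⟶ Q) : CompactSubpair P →o CompactSubpair Q where
  toFun K :=
    { total := K.total.map (TopPair.Hom.fst f) (TopPair.Hom.fst f).hom.continuous
      sub := K.sub.map (TopPair.Hom.snd f) (TopPair.Hom.snd f).hom.continuous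
      mapsTo := by
        rintro _ ⟨x, hx, rfl⟩
        exact ⟨P.map x, K.mapsTo hx, (TopPair.Hom.w_apply f x).symm⟩ }
  monotone' K L h := ⟨Set.image_mono h.1, Set.image_mono h.2⟩

/-- The restriction `(K, K₀) ⟶ (f(K), f(K₀))` of a map of pairs `f`. -/
abbrev restrict (f : P ⟶ Q) (K : CompactSubpair P) : K.toTopPair ⟶ (image f K).toTopPair :=
  TopPair.ofHom
    (TopCat.ofHom ⟨fun x => ⟨TopPair.Hom.fst f x, Set.mem_image_of_mem _ x.2⟩, by fun_prop⟩)
    (TopCat.ofHom ⟨fun x => ⟨TopPair.Hom.snd f x, Set.mem_image_of_mem _ x.2⟩, by fun_prop⟩)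
    (by ext x; exact Subtype.ext (TopPair.Hom.w_apply f x.1))

end CompactSubpair

/-! ### CH-shape cohomology -/

section Shape

/-- The compact subpairs `(K, K₀)` of `(X, X₀)` with their inclusion maps. -/
def compactSubpairFunctor (P : HausdorffPair.{u}) :
    CompactSubpair P.obj ⥤ CompactHausdorffPair.{u} where
  obj K := ⟨K.toTopPair, by
    have : T2Space P.obj.fst := P.property
    exact ⟨inferInstanceAs (T2Space K.total), inferInstanceAs (CompactSpace K.total),
      inferInstanceAs (CompactSpace K.sub)⟩⟩
  map h := ObjectProperty.homMk (CompactSubpair.transition (leOfHom h))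

/-- The system `C(X, X₀)` in `HCpt²` of all compact subpairs of a Hausdorff pair `(X, X₀)`, with
the homotopy classes of the inclusion maps. -/
def associatedSystem (P : HausdorffPair.{u}) : DirectSystem.{u} HCpt2.{u} where
  index := CompactSubpair P.obj
  system := compactSubpairFunctor P ⋙ CategoryTheory.Quotient.functor homotopyRel

variable (G : Type v) [AddCommGroup G] (n : ℕ)

/-- The inverse system `H^n(X^*; G)` of a direct system `X^*` in `HCpt²`. -/
def cohomologySystem (X : DirectSystem.{u} HCpt2.{u}) : X.indexᵒᵖ ⥤ AddCommGrpCat.{max u v} :=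
  X.system.op ⋙ homotopyCohomology G n

/-- The inverse limit of `H^n(X^*; G)`. -/
def cohomologyLimit (X : DirectSystem.{u} HCpt2.{u}) : AddCommGrpCat.{max u v} :=
  limit (cohomologySystem G n X)

/-- The projection of the inverse limit to the group of index `a`. -/
def cohomologyProj (X : DirectSystem.{u} HCpt2.{u}) (a : X.index) :
    cohomologyLimit G n X ⟶ (homotopyCohomology G n).obj (op (X.system.obj a)) :=
  limit.π (cohomologySystem G n X) (op a)

theorem cohomologyLimit_hom_ext {G : Type v} [AddCommGroup G] {n : ℕ} {X : DirectSystem.{u} HCpt2.{u}} {A : AddCommGrpCat.{max u v}}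
    {f g : A ⟶ cohomologyLimit G n X}
    (h : ∀ a, f ≫ cohomologyProj G n X a = g ≫ cohomologyProj G n X a) : f = g :=
  limit.hom_ext fun a => h a.unop

theorem cohomologyProj_map (X : DirectSystem.{u} HCpt2.{u}) {a a' : X.index} (h : a ≤ a') :
    cohomologyProj G n X a' ≫ (homotopyCohomology G n).map (X.system.map (homOfLE h)).op =
      cohomologyProj G n X a :=
  limit.w (cohomologySystem G n X) (homOfLE h).op

/-- The homomorphism to the inverse limit given by compatible homomorphisms `t a`. -/
def cohomologyLimitLift (X : DirectSystem.{u} HCpt2.{u}) {A : AddCommGrpCat.{max u v}}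
    (t : ∀ a, A ⟶ (homotopyCohomology G n).obj (op (X.system.obj a)))
    (h : ∀ (a a' : X.index) (h : a ≤ a'),
      t a' ≫ (homotopyCohomology G n).map (X.system.map (homOfLE h)).op = t a) :
    A ⟶ cohomologyLimit G n X :=
  limit.lift (cohomologySystem G n X)
    { pt := A
      π :=
       { app a := t a.unop
         naturality a a' f := (Category.id_comp _).trans (h a'.unop a.unop (leOfHom f.unop)).symm } }

theorem cohomologyLimitLift_proj (X : DirectSystem.{u} HCpt2.{u}) {A : AddCommGrpCat.{max u v}}
    (t : ∀ a, A ⟶ (homotopyCohomology G n).obj (op (X.system.obj a))) (h) (a : X.index) :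
    cohomologyLimitLift G n X t h ≫ cohomologyProj G n X a = t a :=
  limit.lift_π _ _

/-- The homomorphism of inverse limits induced by a morphism of direct systems. -/
def cohomologyLimitMap {X Y : DirectSystem.{u} HCpt2.{u}} (F : DirectSystem.Hom X Y) :
    cohomologyLimit G n Y ⟶ cohomologyLimit G n X :=
  cohomologyLimitLift G n X
    (fun a => cohomologyProj G n Y (F.indexMap a) ≫ (homotopyCohomology G n).map (F.app a).op)
    (fun a a' h => by
      rw [Category.assoc, ← Functor.map_comp, ← op_comp, ← F.comm h, op_comp, Functor.map_comp,
        ← Category.assoc, cohomologyProj_map])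

theorem cohomologyLimitMap_proj {X Y : DirectSystem.{u} HCpt2.{u}} (F : DirectSystem.Hom X Y)
    (a : X.index) :
    cohomologyLimitMap G n F ≫ cohomologyProj G n X a =
      cohomologyProj G n Y (F.indexMap a) ≫ (homotopyCohomology G n).map (F.app a).op :=
  cohomologyLimitLift_proj _ _ _ _ _ _

/-- The morphism `C(X, X₀) ⟶ C(Y, Y₀)` induced by a map of pairs `f`: it sends the index `(K, K₀)`
to `(f(K), f(K₀))`. -/
def associatedSystemMap {P Q : HausdorffPair.{u}} (f : P ⟶ Q) :
    DirectSystem.Hom (associatedSystem P) (associatedSystem Q) where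
  indexMap := CompactSubpair.image f.hom
  app K := (CategoryTheory.Quotient.functor homotopyRel).map
    (X := (compactSubpairFunctor P).obj K)
    (Y := (compactSubpairFunctor Q).obj (CompactSubpair.image f.hom K))
    (ObjectProperty.homMk (CompactSubpair.restrict f.hom K))
  comm _ := rfl

/-- The `n`-th CH-shape cohomology `Ĥ^n(X, X₀; G) = lim H^n(C(X, X₀); G)`, with the induced
homomorphisms: a contravariant functor on Hausdorff pairs. -/
def shapeCohomology : HausdorffPair.{u}ᵒᵖ ⥤ AddCommGrpCat.{max u v} where
  obj P := cohomologyLimit G n (associatedSystem P.unop)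
  map f := cohomologyLimitMap G n (associatedSystemMap f.unop)
  map_id P := by
    refine cohomologyLimit_hom_ext fun K => ?_
    rw [cohomologyLimitMap_proj, Category.id_comp]
    refine Eq.trans ?_ (cohomologyProj_map G n (associatedSystem P.unop)
      (a' := CompactSubpair.image (𝟙 P.unop.obj) K) 
        ⟨fun x hx => ⟨x, hx, rfl⟩, fun x hx => ⟨x, hx, rfl⟩⟩)
    rfl
  map_comp {P Q R} f g := by
    refine cohomologyLimit_hom_ext fun K => ?_
    rw [cohomologyLimitMap_proj, Category.assoc, cohomologyLimitMap_proj, ← Category.assoc,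
      cohomologyLimitMap_proj]
    have h := cohomologyProj_map G n (associatedSystem P.unop)
      (a := CompactSubpair.image (g.unop ≫ f.unop).hom K)
      (a' := CompactSubpair.image f.unop.hom (CompactSubpair.image g.unop.hom K))
        ⟨by rintro _ ⟨x, hx, rfl⟩; exact ⟨_, ⟨x, hx, rfl⟩, rfl⟩,
         by rintro _ ⟨x, hx, rfl⟩; exact ⟨_, ⟨x, hx, rfl⟩, rfl⟩⟩
    refine (congrArg (fun t => t ≫ _) h.symm).trans ?_
    refine (Category.assoc _ _ _).trans ((congrArg (_ ≫ ·) ?_).trans (Category.assoc _ _ _).symm)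
    have e := (homotopyCohomology G n).map_comp
      ((associatedSystemMap f.unop).app ((associatedSystemMap g.unop).indexMap K)).op
      ((associatedSystemMap g.unop).app K).op
    exact (Functor.map_comp _ _ _).symm.trans e

/-- The pair `(X₀, ∅)` of a Hausdorff pair `(X, X₀)`. -/
def HausdorffPair.subspace (P : HausdorffPair.{u}) : HausdorffPair.{u} :=
  ⟨TopPair.incl.obj P.obj.snd, by
    have : T2Space P.obj.fst := P.property
    exact P.obj.isEmbedding_map.t2Space⟩

/-- The pair `(X₀, ∅)` of a compact Hausdorff pair `(X, X₀)`. -/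
def CompactHausdorffPair.subspace (P : CompactHausdorffPair.{u}) : CompactHausdorffPair.{u} :=
  ⟨TopPair.incl.obj P.obj.snd, by
    have : T2Space P.obj.fst := P.property.1
    exact ⟨P.obj.isEmbedding_map.t2Space, P.property.2.2, inferInstanceAs (CompactSpace PEmpty)⟩⟩

namespace CompactSubpair

variable {P : TopPair.{u}} (K : CompactSubpair P)

/-- The compact subpair `(K₀, ∅)` of `(X₀, ∅)`. -/
abbrev subspace : CompactSubpair (TopPair.incl.obj P.snd) where
  total := K.sub
  sub := ⊥
  mapsTo := fun _ h => h.elim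

/-- The identity map `(K₀, ∅) ⟶ (K₀, ∅)`, between two models of the empty subspace. -/
abbrev toSubspace : TopPair.incl.obj K.toTopPair.snd ⟶ K.subspace.toTopPair :=
  TopPair.ofHom (Y := K.subspace.toTopPair) (𝟙 (TopCat.of K.sub)) (TopCat.isInitialPEmpty.to _) (by
    ext x; exact x.elim)
end CompactSubpair

/-- The coboundary homomorphism `Ĥ^n(X₀; G) ⟶ Ĥ^{n+1}(X, X₀; G)`, `Ĥ^n(X₀) = Ĥ^n(X₀, ∅)`: its
component at `(K, K₀)` is the projection to `H^n(K₀)` followed by the coboundary homomorphism of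
`(K, K₀)`. -/
def shapeCoboundary (P : HausdorffPair.{u}) :
    (shapeCohomology G n).obj (op P.subspace) ⟶ (shapeCohomology G (n + 1)).obj (op P) :=
  cohomologyLimitLift G (n + 1) (associatedSystem P)
    (fun K => cohomologyProj G n (associatedSystem P.subspace) (CompactSubpair.subspace K) ≫
      (cohomology G n).map (CompactSubpair.toSubspace K).op ≫
        coboundary G (CompactSubpair.toTopPair K) n)
    (fun K L h => by
      have h₁ := coboundary_naturality G (CompactSubpair.transition h) n
      have h₂ := cohomologyProj_map G n (associatedSystem P.subspace)
        (a := CompactSubpair.subspace K) (a' := CompactSubpair.subspace L) ⟨h.2, le_rfl⟩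
      rw [← h₂]
      have h₃ : (cohomology G n).map (CompactSubpair.toSubspace L).op ≫
          (cohomology G n).map
            (TopPair.incl.map (TopPair.Hom.snd (CompactSubpair.transition h))).op =
          (homotopyCohomology G n).map ((associatedSystem P.subspace).system.map
            (homOfLE (x := CompactSubpair.subspace K) (y := CompactSubpair.subspace L)
              ⟨h.2, le_rfl⟩)).op ≫ (cohomology G n).map (CompactSubpair.toSubspace K).op := by
        refine (Functor.map_comp _ _ _).symm.trans
          (Eq.trans (congrArg _ ?_) (Functor.map_comp (cohomology G n) _ _))
        refine congrArg Quiver.Hom.op ?_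
        ext x
        · rfl
        · rfl
      calc _ = cohomologyProj G n (associatedSystem P.subspace) (CompactSubpair.subspace L) ≫
            (cohomology G n).map (CompactSubpair.toSubspace L).op ≫
              coboundary G (CompactSubpair.toTopPair L) n ≫
                (cohomology G (n + 1)).map (CompactSubpair.transition h).op := by
            exact (Category.assoc _ _ _).trans (congrArg (_ ≫ ·) (Category.assoc _ _ _))
        _ = cohomologyProj G n (associatedSystem P.subspace) (CompactSubpair.subspace L) ≫
            ((cohomology G n).map (CompactSubpair.toSubspace L).op ≫
              (cohomology G n).map
                (TopPair.incl.map (TopPair.Hom.snd (CompactSubpair.transition h))).op) ≫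
              coboundary G (CompactSubpair.toTopPair K) n := by
            exact congrArg (_ ≫ ·) ((congrArg (_ ≫ ·) h₁.symm).trans (Category.assoc _ _ _).symm)
        _ = _ := by
            exact (congrArg (fun t => _ ≫ t ≫ _) h₃).trans
              ((congrArg (_ ≫ ·) (Category.assoc _ _ _)).trans (Category.assoc _ _ _).symm))

end Shape

end
end CHShape

open CategoryTheory Opposite

/-! When `X` and `X₀` are compact, `(X, X₀)` is itself one of its compact subpairs, and it is the
greatest one. A direct system whose index set has a greatest element is equivalent to its object
there, and an inverse limit over such a set is the group at that element. Both halves of the theorem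
are instances of this.

The subpair `whole P` is built on the subtypes `⊤`, so it is not literally `P`, and an explicit map
`toWhole` is needed. Two strict identities of maps of pairs carry everything: `toWhole_inclusion`
(going to `whole P` and back is the identity of `P`) and `inclusion_toWhole` (including `K` in `P`
and passing to `whole P` is a transition map of the system). They make the two systems equivalent,
and in cohomology they make the projection to the greatest index inverse to the comparison map
`toShape`.

The comparison map exists for every Hausdorff pair. Its compatibility with maps of pairs
(`toShape_naturality`) and with coboundaries (`coboundary_toShape`) is checked one component at a
time, before compactness enters in `shapeIso`. -/

namespace CHShape

open CategoryTheory Limits Opposite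

noncomputable section

/-! ### The greatest compact subpair and identities between inclusions -/

namespace CompactSubpair

section Whole

variable (P : TopPair.{u}) [CompactSpace P.fst] [CompactSpace P.snd]

/-- The greatest compact subpair `(X, X₀)` of a compact pair `(X, X₀)`. -/
def whole : CompactSubpair P where
  total := ⊤
  sub := ⊤
  mapsTo := fun _ _ => trivial

/-- The identity map of a compact pair, with values in its greatest compact subpair. -/
def toWhole : P ⟶ (whole P).toTopPair :=
  TopPair.ofHom (Y := (whole P).toTopPair)
    (TopCat.ofHom ⟨fun x => ⟨x, trivial⟩, by fun_prop⟩)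
    (TopCat.ofHom ⟨fun x => ⟨x, trivial⟩, by fun_prop⟩) (by ext x; rfl)

theorem toWhole_inclusion : toWhole P ≫ (whole P).inclusion = 𝟙 P := by
  ext x <;> rfl

variable {P}

theorem le_whole (K : CompactSubpair P) : K ≤ whole P :=
  ⟨fun _ _ => trivial, fun _ _ => trivial⟩

/-- This lets the map induced by `inclusion K` be traded for a transition map, along which the
elements of the inverse limit are compatible. With `K = whole P` it also shows that `toWhole P` is
inverse to the inclusion on the other side. -/
theorem inclusion_toWhole (K : CompactSubpair P) :
    K.inclusion ≫ toWhole P = transition (le_whole K) := by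
  ext x <;> rfl

end Whole

theorem transition_inclusion {P : TopPair.{u}} {K L : CompactSubpair P} (h : K ≤ L) :
    transition h ≫ L.inclusion = K.inclusion := by
  ext x <;> rfl

theorem restrict_inclusion {P Q : TopPair.{u}} (f : P ⟶ Q) (K : CompactSubpair P) :
    restrict f K ≫ (image f K).inclusion = K.inclusion ≫ f := by
  ext x <;> rfl

/-- Reconciles two models of `(K₀, ∅)`: the coboundary of `(K, K₀)` uses `PEmpty` as the empty
subspace, while the index `subspace K` uses the empty compact subset `⊥`. Needed in
`coboundary_toShape`. -/
theorem toSubspace_inclusion {P : TopPair.{u}} (K : CompactSubpair P) :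
    toSubspace K ≫ (subspace K).inclusion = TopPair.incl.map (TopPair.Hom.snd K.inclusion) := by
  ext x
  · exact PEmpty.elim x
  · rfl

end CompactSubpair

open CompactSubpair

/-! ### Equivalence of the associated system with a single pair -/

theorem associatedSystem_equivalent_single (P : CompactHausdorffPair.{u}) :
    (associatedSystem (CompactHausdorffPair.inclusion.obj P)).Equivalent
      (DirectSystem.single ((CategoryTheory.Quotient.functor homotopyRel).obj P)) := by
  have : CompactSpace P.obj.fst := P.property.2.1
  have : CompactSpace P.obj.snd := P.property.2.2
  let C := associatedSystem (CompactHausdorffPair.inclusion.obj P)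
  let S := DirectSystem.single ((CategoryTheory.Quotient.functor homotopyRel).obj P)
  let J := compactSubpairFunctor (CompactHausdorffPair.inclusion.obj P)
  let q := CategoryTheory.Quotient.functor homotopyRel.{u}
  let i (K : CompactSubpair P.obj) : J.obj K ⟶ P := ObjectProperty.homMk K.inclusion
  let r : P ⟶ J.obj (whole P.obj) := ObjectProperty.homMk (toWhole P.obj)
  -- These three identities hold strictly for maps of pairs; applying the quotient functor `q`
  -- passes them to homotopy classes, and no nontrivial homotopy is ever constructed.
  have hi {K L : CompactSubpair P.obj} (h : K ≤ L) : J.map (homOfLE h) ≫ i L = i K :=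
    ObjectProperty.hom_ext _ (transition_inclusion h)
  have hr (K : CompactSubpair P.obj) : i K ≫ r = J.map (homOfLE (le_whole K)) :=
    ObjectProperty.hom_ext _ (inclusion_toWhole (P := P.obj) K)
  have hri : r ≫ i (whole P.obj) = 𝟙 P := ObjectProperty.hom_ext _ (toWhole_inclusion P.obj)
  let F : DirectSystem.Hom C S :=
    { indexMap := ⟨fun _ => (), fun _ _ _ => le_rfl⟩
      app := fun K => q.map (i K)
      comm := fun {K L} h => (Category.comp_id _).trans
        ((congrArg q.map (hi h).symm).trans (q.map_comp _ _)) }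
  let F' : DirectSystem.Hom S C :=
    { indexMap := ⟨fun _ => whole P.obj, fun _ _ _ => le_rfl⟩
      app := fun _ => q.map r
      comm := fun _ => (congrArg (_ ≫ ·) (C.system.map_id (whole P.obj))).trans
        ((Category.comp_id _).trans (Category.id_comp _).symm) }
  -- The round trip on `C` moves the index `K` to `whole P.obj`, so it can be compared with the
  -- identity only after moving `K` up to that greatest index. On the one-element system the index
  -- does not move.
  refine ⟨F, F', fun K => ⟨whole P.obj, le_rfl, le_whole (P := P.obj) K, ?_⟩,
    fun a => ⟨a, le_rfl, le_rfl, ?_⟩⟩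
  · exact (congrArg (_ ≫ ·) (C.system.map_id (whole P.obj))).trans ((Category.comp_id _).trans
      (((q.map_comp _ _).symm.trans (congrArg q.map (hr K))).trans (Category.id_comp _).symm))
  · exact congrArg (· ≫ _)
      ((q.map_comp _ _).symm.trans ((congrArg q.map hri).trans (q.map_id P)))

/-! ### The comparison homomorphism from singular to CH-shape cohomology -/

variable (G : Type v) [AddCommGroup G] (n : ℕ)

variable {G n} in
theorem cohomology_map_comp {P Q R : TopPair.{u}} {f : P ⟶ Q} {g : Q ⟶ R} {h : P ⟶ R}
    (w : f ≫ g = h) :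
    (cohomology G n).map g.op ≫ (cohomology G n).map f.op = (cohomology G n).map h.op := by
  rw [← Functor.map_comp, ← op_comp, w]

/-- The projection `Ĥ^n(X, X₀) ⟶ H^n(K, K₀)`. -/
def shapeProj (P : HausdorffPair.{u}) (K : CompactSubpair P.obj) :
    (shapeCohomology G n).obj (op P) ⟶ (cohomology G n).obj (op K.toTopPair) :=
  cohomologyProj G n (associatedSystem P) K

-- This and the next three lemmas are the defining properties of the limit, read through the
-- definitional agreement of `homotopyCohomology` on classes with `cohomology` on pairs. Later
-- arguments thus reduce to identities between maps of pairs.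
variable {G n} in
theorem shapeCohomology_hom_ext {P : HausdorffPair.{u}} {A : AddCommGrpCat.{max u v}}
    {f g : A ⟶ (shapeCohomology G n).obj (op P)}
    (h : ∀ K : CompactSubpair P.obj, f ≫ shapeProj G n P K = g ≫ shapeProj G n P K) : f = g :=
  cohomologyLimit_hom_ext h

theorem shapeProj_transition (P : HausdorffPair.{u}) {K L : CompactSubpair P.obj} (h : K ≤ L) :
    shapeProj G n P L ≫ (cohomology G n).map (transition h).op = shapeProj G n P K :=
  cohomologyProj_map G n (associatedSystem P) h

theorem shapeCohomology_map_shapeProj {P Q : HausdorffPair.{u}} (f : P ⟶ Q)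
    (K : CompactSubpair P.obj) :
    (shapeCohomology G n).map f.op ≫ shapeProj G n P K =
      shapeProj G n Q (image f.hom K) ≫ (cohomology G n).map (restrict f.hom K).op :=
  cohomologyLimitMap_proj G n (associatedSystemMap f) K

theorem shapeCoboundary_shapeProj (P : HausdorffPair.{u}) (K : CompactSubpair P.obj) :
    shapeCoboundary G n P ≫ shapeProj G (n + 1) P K =
      shapeProj G n P.subspace (subspace K) ≫
        (cohomology G n).map (toSubspace K).op ≫ coboundary G K.toTopPair n :=
  cohomologyLimitLift_proj G (n + 1) (associatedSystem P) _ _ K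

/-- The comparison homomorphism `H^n(X, X₀) ⟶ Ĥ^n(X, X₀)`, with components induced by the
inclusions of the compact subpairs. -/
def toShape (P : HausdorffPair.{u}) :
    (cohomology G n).obj (op P.obj) ⟶ (shapeCohomology G n).obj (op P) :=
  cohomologyLimitLift G n (associatedSystem P)
    (fun K => (cohomology G n).map (CompactSubpair.inclusion (P := P.obj) K).op)
    (fun _ _ h => cohomology_map_comp (transition_inclusion (P := P.obj) h))

theorem toShape_shapeProj (P : HausdorffPair.{u}) (K : CompactSubpair P.obj) :
    toShape G n P ≫ shapeProj G n P K = (cohomology G n).map K.inclusion.op :=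
  cohomologyLimitLift_proj G n (associatedSystem P) _ _ K

/-- At `K`, both sides are induced by one and the same map from `K` to `Q`: include and apply `f`,
or restrict `f` to its image and then include. -/
theorem toShape_naturality {P Q : HausdorffPair.{u}} (f : P ⟶ Q) :
    (cohomology G n).map f.hom.op ≫ toShape G n P =
      toShape G n Q ≫ (shapeCohomology G n).map f.op := by
  refine shapeCohomology_hom_ext fun K => ?_
  rw [Category.assoc, toShape_shapeProj, Category.assoc, shapeCohomology_map_shapeProj,
    ← Category.assoc, toShape_shapeProj, cohomology_map_comp (restrict_inclusion f.hom K),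
    cohomology_map_comp rfl]

/-- At `K` this is naturality of the singular coboundary for the inclusion of `K` in `P`, once the
restriction to `K₀` is factored through the component of `toShape` at `subspace K`. -/
theorem coboundary_toShape (P : HausdorffPair.{u}) :
    coboundary G P.obj n ≫ toShape G (n + 1) P =
      toShape G n P.subspace ≫ shapeCoboundary G n P := by
  refine shapeCohomology_hom_ext fun K => ?_
  have h : (cohomology G n).map (subspace K).inclusion.op ≫
      (cohomology G n).map (toSubspace K).op =
        (cohomology G n).map (TopPair.incl.map (TopPair.Hom.snd K.inclusion)).op :=
    cohomology_map_comp (toSubspace_inclusion K)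
  have h' : toShape G n P.subspace ≫ shapeProj G n P.subspace (subspace K) =
      (cohomology G n).map (subspace K).inclusion.op :=
    toShape_shapeProj G n P.subspace (subspace K)
  rw [Category.assoc, toShape_shapeProj, ← coboundary_naturality, ← h, ← h']
  refine (Category.assoc _ _ _).trans ((Category.assoc _ _ _).trans ?_)
  exact (congrArg (toShape G n P.subspace ≫ ·) (shapeCoboundary_shapeProj G n P K).symm).trans
    (Category.assoc _ _ _).symm

/-- On compact pairs the comparison homomorphism is an isomorphism, with inverse the projection to
the component of the greatest compact subpair. -/
def shapeIso (P : HausdorffPair.{u}) [CompactSpace P.obj.fst] [CompactSpace P.obj.snd] :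
    (cohomology G n).obj (op P.obj) ≅ (shapeCohomology G n).obj (op P) where
  hom := toShape G n P
  inv := shapeProj G n P (whole P.obj) ≫ (cohomology G n).map (toWhole P.obj).op
  hom_inv_id := by
    rw [← Category.assoc, toShape_shapeProj, cohomology_map_comp (toWhole_inclusion P.obj),
      op_id, CategoryTheory.Functor.map_id]
  inv_hom_id := by
    refine shapeCohomology_hom_ext fun K => ?_
    -- The component at `K` becomes the projection at `whole P.obj` followed by a transition map,
    -- which is the projection at `K` by compatibility in the limit.
    rw [Category.assoc, toShape_shapeProj, Category.assoc,
      cohomology_map_comp (inclusion_toWhole K), shapeProj_transition, Category.id_comp]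

/-- `shapeIso` for the objects of the category of compact Hausdorff pairs. -/
def compactShapeIso (P : CompactHausdorffPair.{u}) :
    (cohomology G n).obj (op P.obj) ≅
      (shapeCohomology G n).obj (op (CompactHausdorffPair.inclusion.obj P)) :=
  have : CompactSpace (CompactHausdorffPair.inclusion.obj P).obj.fst := P.property.2.1
  have : CompactSpace (CompactHausdorffPair.inclusion.obj P).obj.snd := P.property.2.2
  shapeIso G n (CompactHausdorffPair.inclusion.obj P)

end

end CHShape

theorem mainTheorem7 (G : Type v) [AddCommGroup G] :
    (∀ P : CHShape.CompactHausdorffPair.{u},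
      (CHShape.associatedSystem (CHShape.CompactHausdorffPair.inclusion.obj P)).Equivalent
        (CHShape.DirectSystem.single
          ((CategoryTheory.Quotient.functor CHShape.homotopyRel).obj P))) ∧
    ∃ Φ : ∀ n : ℕ, CHShape.IsCompactHausdorffPair.{u}.ι.op ⋙ CHShape.cohomology G n ≅
        CHShape.CompactHausdorffPair.inclusion.op ⋙ CHShape.shapeCohomology G n,
      (∀ (n : ℕ) (P : CHShape.CompactHausdorffPair.{u}) (K : CHShape.CompactSubpair P.obj),
        (Φ n).hom.app (op P) ≫ CHShape.cohomologyProj G n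
            (CHShape.associatedSystem (CHShape.CompactHausdorffPair.inclusion.obj P)) K =
          (CHShape.cohomology G n).map K.inclusion.op) ∧
      (∀ (n : ℕ) (P : CHShape.CompactHausdorffPair.{u}),
        CHShape.coboundary G P.obj n ≫ (Φ (n + 1)).hom.app (op P) =
          (Φ n).hom.app (op P.subspace) ≫
            CHShape.shapeCoboundary G n (CHShape.CompactHausdorffPair.inclusion.obj P)) := by

  -- The inclusion of compact Hausdorff pairs into Hausdorff pairs leaves the underlying pair
  -- unchanged and commutes definitionally with forming `(X₀, ∅)`, so the statements for Hausdorff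
  -- pairs apply as they stand.
  exact ⟨CHShape.associatedSystem_equivalent_single,
    fun n => NatIso.ofComponents (fun P => CHShape.compactShapeIso G n P.unop)
      (fun f => CHShape.toShape_naturality G n (CHShape.CompactHausdorffPair.inclusion.map f.unop)),
    fun n P K => CHShape.toShape_shapeProj G n (CHShape.CompactHausdorffPair.inclusion.obj P) K,
    fun n P => CHShape.coboundary_toShape G n (CHShape.CompactHausdorffPair.inclusion.obj P)⟩
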